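/- **Definitions.** All Hilbert spaces are finite-dimensional. An $r$-player nonlocal game $H$ consists of finite sets of input tuples $\mathcal I=\mathcal I_1\times\cdots\times\mathcal I_r$ and output tuples $\mathcal O=\mathcal O_1\times\cdots\times\mathcal O_r$, a probability distribution $p$ on $\mathcal I$, and a scoring function $L:\mathcal I\times\mathcal O\to\mathbb R$. The game $H^N$ has inputs $\mathbf u\in\mathcal I^N$ with distribution $\prod_j p(u_j)$, outputs $\mathbf t\in\mathcal O^N$, and score $\sum_{j=1}^N L(u_j,t_j)$. A measurement strategy on a Hilbert space $S$ is a family, indexed by inputs, of positive operator-valued measures on $S$ indexed by outputs. A measurement strategy $\{\{E_i^o\}_{o\in\mathcal O}\}_{i\in\mathcal I}$ on $S$ is $r$-partite if, under some unitary identification $S\cong Q_1\otimes\cdots\otimes Q_r$, $E_i^o=E_{1,i_1}^{o_1}\otimes\cdots\otimes E_{r,i_r}^{o_r}$ for all $i,o$, where $\{\{E_{k,i_k}^{o_k}\}_{o_k\in\mathcal O_k}\}_{i_k\in\mathcal I_k}$ is a measurement strategy on $Q_k$ for each $k$. The value $\omega(H)$ is the supremum, over all $r$-partite measurement strategies $\{\{E_i^o\}\}$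 and all density operators $\rho$ on $Q_1\otimes\cdots\otimes Q_r$, of the expected score $\sum_{i,o}p(i)\,\mathrm{Tr}(E_i^o\rho)\,L(i,o)$. Let $\mathbf F=\{\{F_{\mathbf u}^{\mathbf t}\}_{\mathbf t\in\mathcal O^N}\}_{\mathbf u\in\mathcal I^N}$ be a measurement strategy on $Q$. It is sequential if for all $0\le i\le N$ the operator $F_{\mathbf u}^{t_1\cdots t_i}:=\sum_{t_{i+1},\dots,t_N}F_{\mathbf u}^{t_1\cdots t_N}$ does not depend on $u_{i+1},\dots,u_N$; it is then written $F_{u_1\cdots u_i}^{t_1\cdots t_i}$. For $0\le i<N$ and $u_1,\dots,u_i,t_1,\dots,t_i$ with $A:=F_{u_1\cdots u_i}^{t_1\cdots t_i}\neq0$, the conditional strategy is the measurement strategy $\{\{A^{-1/2}F_{u_1\cdots u_{i+1}}^{t_1\cdots t_{i+1}}A^{-1/2}\}_{t_{i+1}}\}_{u_{i+1}}$ on the support of $A$, where $A^{-1/2}$ is the inverse on the support of $A$, extended by $0$. A sequential measurement strategy for $H^N$ is $r$-partite if all its conditional strategies are $r$-partite. **Proposition.** Let $r,N\ge 0$ be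 integers, let $K>0$ and $\delta\ge0$ be real numbers, let $H$ be an $r$-player nonlocal game whose scoring function takes values in $[-K,K]$, let $\mathbf F$ be an $r$-partite sequential measurement strategy for $H^N$ on a Hilbert space $Q$, and let $\phi$ be a density operator on $Q$. Let $(\mathbf u,\mathbf t)$ have joint probability $\prod_j p(u_j)\cdot\mathrm{Tr}(F_{\mathbf u}^{\mathbf t}\phi)$. Then $$\Pr\Big[\sum_{j=1}^N L(u_j,t_j)>(\omega(H)+\delta)N\Big]\le \exp\!\Big(-\frac{N\delta^2}{8K^2}\Big).$$ -/

import Mathlib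

open scoped Matrix BigOperators ComplexOrder

noncomputable section

/-- A finite game: a probability distribution on inputs `U` and a real score on input/output
pairs. -/
structure Game (U T : Type*) [Fintype U] where
  dist : U → ℝ
  dist_nonneg : ∀ u, 0 ≤ dist u
  dist_sum : ∑ u, dist u = 1
  score : U → T → ℝ

/-- An `r`-player nonlocal game: inputs and outputs are tuples, player `k` having input
alphabet `I k` and output alphabet `O k`. -/
abbrev NonlocalGame {r : ℕ} (I O : Fin r → Type*) [∀ k, Fintype (I k)] :=
  Game (∀ k, I k) (∀ k, O k)

/-- The `N`-fold direct product `H ^ N`: independent inputs, and the score is the sum of the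
scores. -/
def Game.repeated {U T : Type*} [Fintype U] (H : Game U T) (N : ℕ) :
    Game (Fin N → U) (Fin N → T) where
  dist u := ∏ j, H.dist (u j)
  dist_nonneg u := Finset.prod_nonneg fun j _ => H.dist_nonneg (u j)
  dist_sum := by
    have h := (Finset.prod_univ_sum (fun _ : Fin N => (Finset.univ : Finset U))
      (fun _ u => H.dist u)).symm
    rw [Fintype.piFinset_univ] at h
    rw [h]
    simp [H.dist_sum]
  score u t := ∑ j, H.score (u j) (t j)

/-- Density operators on the register with orthonormal basis `Q`. -/
def IsState {Q : Type*} [Fintype Q] (φ : Matrix Q Q ℂ) : Prop :=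
  φ.PosSemidef ∧ φ.trace = 1

/-- A measurement strategy on the register `Q`: for each input a positive operator-valued
measure on `Q`. -/
def IsMeasurementStrategy {Q U T : Type*} [DecidableEq Q] [Fintype T]
    (F : U → T → Matrix Q Q ℂ) : Prop :=
  (∀ u t, (F u t).PosSemidef) ∧ ∀ u, ∑ t, F u t = 1

/-- The expected score of the strategy `(F, φ)`. -/
def Game.expectedScore {U T Q : Type*} [Fintype U] [Fintype T] [Fintype Q]
    (G : Game U T) (F : U → T → Matrix Q Q ℂ) (φ : Matrix Q Q ℂ) : ℝ :=
  ∑ u, ∑ t, G.dist u * (F u t * φ).trace.re * G.score u t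

open Classical in
/-- The probability that the score of the strategy `(F, φ)` exceeds `c`. -/
def Game.probScoreExceeds {U T Q : Type*} [Fintype U] [Fintype T] [Fintype Q]
    (G : Game U T) (F : U → T → Matrix Q Q ℂ) (φ : Matrix Q Q ℂ) (c : ℝ) : ℝ :=
  ∑ u, ∑ t with c < G.score u t, G.dist u * (F u t * φ).trace.re

/-- The strategy `F_{1, i_1}^{o_1} ⊗ ⋯ ⊗ F_{r, i_r}^{o_r}` on the register `Q_1 ⊗ ⋯ ⊗ Q_r`,
whose basis is the product of the bases of the `Q_k`. -/
def productStrategy {r : ℕ} {I O D : Fin r → Type*}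
    (F : ∀ k, I k → O k → Matrix (D k) (D k) ℂ) (u : ∀ k, I k) (t : ∀ k, O k) :
    Matrix (∀ k, D k) (∀ k, D k) ℂ :=
  Matrix.of fun x y => ∏ k, F k (u k) (t k) (x k) (y k)

/-- The quantum value: the supremum of the expected score over all `r`-partite quantum strategies
(on arbitrary finite-dimensional registers `Q_1, …, Q_r`). -/
def quantumValue {r : ℕ} {I O : Fin r → Type*} [∀ k, Fintype (I k)] [∀ k, Fintype (O k)]
    (H : NonlocalGame I O) : ℝ :=
  sSup {x | ∃ (d : Fin r → ℕ) (F : ∀ k, I k → O k → Matrix (Fin (d k)) (Fin (d k)) ℂ)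
    (φ : Matrix (∀ k, Fin (d k)) (∀ k, Fin (d k)) ℂ),
    (∀ k, IsMeasurementStrategy (F k)) ∧ IsState φ ∧
      x = H.expectedScore (productStrategy F) φ}

/-- `E`, a measurement strategy on a subspace `S` of the register `Q` (extended by zero on the
orthogonal complement of `S`), is `r`-partite: `S` is identified, by an isometry `V` onto it, with
a tensor product `Q_1 ⊗ ⋯ ⊗ Q_r`, and under this identification `E` is a product strategy.
The equation forces `∑ t, E u t = V * Vᴴ`, so `S` is the whole of `Q` if the `E u t` add up
to `1`. -/
def IsPartite {r : ℕ} {I O : Fin r → Type*} [∀ k, Fintype (O k)] {Q : Type*} [Fintype Q]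
    (E : (∀ k, I k) → (∀ k, O k) → Matrix Q Q ℂ) : Prop :=
  ∃ (d : Fin r → ℕ) (F : ∀ k, I k → O k → Matrix (Fin (d k)) (Fin (d k)) ℂ)
    (V : Matrix Q (∀ k, Fin (d k)) ℂ),
    (∀ k, IsMeasurementStrategy (F k)) ∧ Vᴴ * V = 1 ∧
      ∀ u t, E u t = V * productStrategy F u t * Vᴴ

open Classical in
/-- The operator `F_u^{t_1 ⋯ t_i}`: the sum of `F_u^s` over all output sequences `s` whose first
`i` entries are those of `t`. -/
def prefixOp {N : ℕ} {U T Q : Type*} [Fintype T] (F : (Fin N → U) → (Fin N → T) → Matrix Q Q ℂ)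
    (i : ℕ) (u : Fin N → U) (t : Fin N → T) : Matrix Q Q ℂ :=
  ∑ s with ∀ j : Fin N, (j : ℕ) < i → s j = t j, F u s

/-- A strategy is sequential if `F_u^{t_1 ⋯ t_i}` does not depend on the inputs after the
`i`-th. -/
def IsSequential {N : ℕ} {U T Q : Type*} [Fintype T]
    (F : (Fin N → U) → (Fin N → T) → Matrix Q Q ℂ) : Prop :=
  ∀ i ≤ N, ∀ (u u' : Fin N → U) (t : Fin N → T),
    (∀ j : Fin N, (j : ℕ) < i → u j = u' j) → prefixOp F i u t = prefixOp F i u' t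

/-- `A ^ (-1/2)` for a positive semidefinite `A`, taken on the support of `A` and extended by zero
(the function `x ↦ (√x)⁻¹` vanishes at `0`). -/
def invSqrt {Q : Type*} [Fintype Q] [DecidableEq Q] (A : Matrix Q Q ℂ) : Matrix Q Q ℂ :=
  cfc (fun x : ℝ => (√x)⁻¹) A

/-- The conditional strategy for round `i` (rounds are numbered from `0`), given the inputs
`u j` and outputs `t j` of the rounds `j < i`. It is a measurement strategy on the support of
`prefixOp F i u t`; the entries of `u` and `t` from `i` on are irrelevant for sequential `F`. -/
def conditionalStrategy {N : ℕ} {U T Q : Type*} [Fintype T] [Fintype Q] [DecidableEq Q]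
    (F : (Fin N → U) → (Fin N → T) → Matrix Q Q ℂ) (i : Fin N) (u : Fin N → U) (t : Fin N → T)
    (v : U) (s : T) : Matrix Q Q ℂ :=
  invSqrt (prefixOp F i u t) *
    prefixOp F (i + 1) (Function.update u i v) (Function.update t i s) *
    invSqrt (prefixOp F i u t)

/-- An `r`-partite sequential measurement strategy for the `N`-fold repetition of a game. -/
structure IsPartiteSequentialStrategy {r N : ℕ} {I O : Fin r → Type*} [∀ k, Fintype (O k)]
    {Q : Type*} [Fintype Q] [DecidableEq Q]
    (F : (Fin N → ∀ k, I k) → (Fin N → ∀ k, O k) → Matrix Q Q ℂ) : Prop where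
  measurement : IsMeasurementStrategy F
  sequential : IsSequential F
  partite : ∀ (i : Fin N) (u : Fin N → ∀ k, I k) (t : Fin N → ∀ k, O k),
    prefixOp F i u t ≠ 0 → IsPartite (conditionalStrategy F i u t)

end

/-! Conditioned on the first rounds, an `r`-partite sequential strategy is an `r`-partite strategy
for `H`, so the conditional expectation of the next score is at most `ω(H)`. Hoeffding's lemma then
bounds the conditional exponential moment of each score, and the bounds multiply up as in the
Azuma–Hoeffding inequality. All conditional states and strategies are kept unnormalized, so that
no division by a possibly vanishing probability occurs. -/

open Matrix

section PosSemidef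

variable {𝕜 n : Type*} [RCLike 𝕜]

open scoped MatrixOrder in
theorem posSemidef_trace_mul_nonneg [Fintype n] {A B : Matrix n n 𝕜} (hA : A.PosSemidef)
    (hB : B.PosSemidef) : 0 ≤ (A * B).trace := by
  classical
  obtain ⟨C, rfl⟩ := CStarAlgebra.nonneg_iff_eq_star_mul_self.mp hA.nonneg
  rw [Matrix.mul_assoc, trace_mul_comm]
  exact (hB.mul_mul_conjTranspose_same C).trace_nonneg

open scoped MatrixOrder in
theorem mul_eq_zero_of_posSemidef_of_le {m : Type*} [Fintype n] {A B : Matrix n n 𝕜}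
    (hB : B.PosSemidef) (hBA : B ≤ A) {P : Matrix n m 𝕜} (hAP : A * P = 0) : B * P = 0 := by
  ext i j
  have hAx : A *ᵥ P.col j = 0 := by ext k; exact congrFun₂ hAP k j
  have hle : star (P.col j) ⬝ᵥ B *ᵥ P.col j ≤ 0 := by
    simpa [sub_mulVec, hAx] using (le_iff.mp hBA).dotProduct_mulVec_nonneg (P.col j)
  exact congrFun ((hB.dotProduct_mulVec_zero_iff _).mp
    (hle.antisymm (hB.dotProduct_mulVec_nonneg _))) i

theorem posSemidef_of_prod {ι : Type*} (s : Finset ι) {A : ι → Matrix n n 𝕜}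
    (hA : ∀ k, (A k).PosSemidef) : (of fun x y => ∏ k ∈ s, A k x y).PosSemidef := by
  classical
  induction s using Finset.induction_on with
  | empty =>
    simpa [submatrix] using! (PosSemidef.one (n := Unit) (R := 𝕜)).submatrix fun _ : n => ()
  | insert k s hk ih => simpa [Finset.prod_insert hk, hadamard] using! (hA k).hadamard ih

end PosSemidef

section Hoeffding

variable {ι : Type*} [Fintype ι] {w X : ι → ℝ} {a b : ℝ}

theorem sum_mul_exp_le_of_sum_eq_one (hw : ∀ i, 0 ≤ w i) (hw1 : ∑ i, w i = 1)
    (hX : ∀ i, X i ∈ Set.Icc a b) (l : ℝ) :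
    ∑ i, w i * Real.exp (l * X i) ≤
      Real.exp (l * ∑ i, w i * X i + l ^ 2 * (b - a) ^ 2 / 8) := by
  let : MeasurableSpace ι := ⊤
  let p : PMF ι := PMF.ofFintype (fun i => ENNReal.ofReal (w i)) <| by
    rw [← ENNReal.ofReal_sum_of_nonneg fun i _ => hw i, hw1, ENNReal.ofReal_one]
  have hp : ∀ f : ι → ℝ, ∫ i, f i ∂p.toMeasure = ∑ i, w i * f i := fun f => by
    simp [PMF.integral_eq_sum, p, ENNReal.toReal_ofReal (hw _)]
  have hmgf := (ProbabilityTheory.hasSubgaussianMGF_of_mem_Icc (μ := p.toMeasure)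
    (Measurable.of_discrete (f := X)).aemeasurable (.of_forall hX)).mgf_le l
  simp only [ProbabilityTheory.mgf, hp, mul_sub, Real.exp_sub, mul_div_assoc', ← Finset.sum_div]
    at hmgf
  rw [div_le_iff₀ (Real.exp_pos _), ← Real.exp_add] at hmgf
  refine hmgf.trans_eq (congrArg Real.exp ?_)
  push_cast
  rw [div_pow, Real.norm_eq_abs, sq_abs]
  ring

theorem sum_mul_exp_le_of_sum_mul_le (hw : ∀ i, 0 ≤ w i) (hX : ∀ i, X i ∈ Set.Icc a b) {m : ℝ}
    (hm : ∑ i, w i * X i ≤ m * ∑ i, w i) {l : ℝ} (hl : 0 ≤ l) :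
    ∑ i, w i * Real.exp (l * X i) ≤
      Real.exp (l * m + l ^ 2 * (b - a) ^ 2 / 8) * ∑ i, w i := by
  set W := ∑ i, w i with hW
  rcases (Finset.sum_nonneg fun i _ => hw i : 0 ≤ W).eq_or_lt with hW0 | hWpos
  · have hw0 : ∀ i, w i = 0 := by
      simpa [Finset.sum_eq_zero_iff_of_nonneg fun i _ => hw i] using hW0.symm
    simp [hw0, hW]
  have hmean : ∑ i, w i / W * X i ≤ m := by
    simp only [div_mul_eq_mul_div, ← Finset.sum_div]
    exact (div_le_iff₀ hWpos).mpr hm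
  have hmgf := sum_mul_exp_le_of_sum_eq_one (w := fun i => w i / W)
    (fun i => div_nonneg (hw i) hWpos.le) (by rw [← Finset.sum_div, div_self hWpos.ne']) hX l
  simp only [div_mul_eq_mul_div, ← Finset.sum_div (s := Finset.univ)] at hmgf hmean
  exact (div_le_iff₀ hWpos).mp (hmgf.trans (by gcongr))

end Hoeffding

section Expectation

variable {U T Q : Type*} [Fintype U] [Fintype Q]

theorem Game.dist_mul_trace_nonneg (G : Game U T) {F : U → T → Matrix Q Q ℂ} {φ : Matrix Q Q ℂ}
    (hF : ∀ u t, (F u t).PosSemidef) (hφ : φ.PosSemidef) (u : U) (t : T) :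
    0 ≤ G.dist u * (F u t * φ).trace.re :=
  mul_nonneg (G.dist_nonneg u) (Complex.le_def.mp (posSemidef_trace_mul_nonneg (hF u t) hφ)).1

variable [Fintype T]

/-- The expectation of `X u t`, where `u` is drawn from the input distribution of `G` and `t` is
the outcome of measuring `φ` with `F u`. Neither `F` nor `φ` has to be normalized, the total mass
being `G.expectation F φ 1`. -/
noncomputable def Game.expectation (G : Game U T) (F : U → T → Matrix Q Q ℂ) (φ : Matrix Q Q ℂ)
    (X : U → T → ℝ) : ℝ :=
  ∑ u, ∑ t, G.dist u * (F u t * φ).trace.re * X u t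

namespace Game

variable {G : Game U T} {F : U → T → Matrix Q Q ℂ} {φ : Matrix Q Q ℂ}

theorem expectation_mono (hF : ∀ u t, (F u t).PosSemidef) (hφ : φ.PosSemidef)
    {X Y : U → T → ℝ} (hXY : ∀ u t, X u t ≤ Y u t) :
    G.expectation F φ X ≤ G.expectation F φ Y :=
  Finset.sum_le_sum fun u _ => Finset.sum_le_sum fun t _ =>
    mul_le_mul_of_nonneg_left (hXY u t) (G.dist_mul_trace_nonneg hF hφ u t)

theorem expectation_const_mul (G : Game U T) (F : U → T → Matrix Q Q ℂ) (φ : Matrix Q Q ℂ)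
    (c : ℝ) (X : U → T → ℝ) :
    G.expectation F φ (fun u t => c * X u t) = c * G.expectation F φ X := by
  simp only [expectation, Finset.mul_sum, mul_left_comm]

theorem expectation_const (G : Game U T) (F : U → T → Matrix Q Q ℂ) (φ : Matrix Q Q ℂ) (c : ℝ) :
    G.expectation F φ (fun _ _ => c) = c * G.expectation F φ 1 := by
  simpa only [Pi.one_apply, mul_one] using G.expectation_const_mul F φ c 1

theorem expectation_smul_state (G : Game U T) (F : U → T → Matrix Q Q ℂ) (φ : Matrix Q Q ℂ)
    (c : ℝ) (X : U → T → ℝ) : G.expectation F (c • φ) X = c * G.expectation F φ X := by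
  simp only [expectation, Matrix.mul_smul, trace_smul, Complex.smul_re, smul_eq_mul,
    Finset.mul_sum, mul_left_comm, mul_assoc]

theorem expectation_conj {R : Type*} [Fintype R] (G : Game U T) (F : U → T → Matrix R R ℂ)
    (V : Matrix Q R ℂ) (φ : Matrix Q Q ℂ) (X : U → T → ℝ) :
    G.expectation (fun u t => V * F u t * Vᴴ) φ X = G.expectation F (Vᴴ * φ * V) X := by
  have htrace : ∀ u t, (V * F u t * Vᴴ * φ).trace = (F u t * (Vᴴ * φ * V)).trace := fun u t => by
    rw [Matrix.mul_assoc, Matrix.mul_assoc, trace_mul_comm, Matrix.mul_assoc, Matrix.mul_assoc]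
  simp only [expectation, htrace]

theorem expectation_one [DecidableEq Q] (G : Game U T) (hF : IsMeasurementStrategy F)
    (φ : Matrix Q Q ℂ) : G.expectation F φ 1 = φ.trace.re := by
  have hsum : ∀ u, ∑ t, (F u t * φ).trace.re = φ.trace.re := fun u => by
    rw [← Complex.re_sum, ← trace_sum, ← Finset.sum_mul, hF.2 u, Matrix.one_mul]
  simp only [expectation, Pi.one_apply, mul_one, ← Finset.mul_sum, hsum, ← Finset.sum_mul,
    G.dist_sum, one_mul]

theorem expectation_exp_le (hF : ∀ u t, (F u t).PosSemidef) (hφ : φ.PosSemidef) {X : U → T → ℝ}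
    {a b : ℝ} (hX : ∀ u t, X u t ∈ Set.Icc a b) {ω : ℝ}
    (hmean : G.expectation F φ X ≤ ω * G.expectation F φ 1) {l : ℝ} (hl : 0 ≤ l) :
    G.expectation F φ (fun u t => Real.exp (l * X u t)) ≤
      Real.exp (l * ω + l ^ 2 * (b - a) ^ 2 / 8) * G.expectation F φ 1 := by
  have hoeffding := sum_mul_exp_le_of_sum_mul_le
    (w := fun x : U × T => G.dist x.1 * (F x.1 x.2 * φ).trace.re) (X := fun x => X x.1 x.2)
    (m := ω) (fun x => G.dist_mul_trace_nonneg hF hφ x.1 x.2) (fun x => hX x.1 x.2)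
  simp only [Fintype.sum_prod_type] at hoeffding
  simp only [expectation, Pi.one_apply, mul_one] at hmean ⊢
  exact hoeffding hmean hl

theorem probScoreExceeds_le_exp_mul_expectation (hF : ∀ u t, (F u t).PosSemidef)
    (hφ : φ.PosSemidef) (c : ℝ) {l : ℝ} (hl : 0 ≤ l) :
    G.probScoreExceeds F φ c ≤
      Real.exp (-(l * c)) * G.expectation F φ fun u t => Real.exp (l * G.score u t) := by
  rw [← expectation_const_mul]
  simp only [← Real.exp_add, probScoreExceeds, Finset.sum_filter]
  refine Finset.sum_le_sum fun u _ => Finset.sum_le_sum fun t _ => ?_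
  have hprob := G.dist_mul_trace_nonneg hF hφ u t
  split_ifs with hc
  · refine le_mul_of_one_le_right hprob (Real.one_le_exp ?_)
    linarith [mul_le_mul_of_nonneg_left hc.le hl]
  · positivity

end Game

end Expectation

section QuantumValue

variable {r : ℕ} {I O : Fin r → Type*} [∀ k, Fintype (O k)]

theorem IsMeasurementStrategy.productStrategy {D : Fin r → Type*} [∀ k, DecidableEq (D k)]
    {F : ∀ k, I k → O k → Matrix (D k) (D k) ℂ} (hF : ∀ k, IsMeasurementStrategy (F k)) :
    IsMeasurementStrategy (productStrategy F) := by
  refine ⟨fun u t => posSemidef_of_prod Finset.univ fun k =>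
    ((hF k).1 (u k) (t k)).submatrix fun x : ∀ k, D k => x k, fun u => ?_⟩
  have hsum : ∀ k x y, ∑ o, F k (u k) o x y = (1 : Matrix (D k) (D k) ℂ) x y := fun k x y => by
    rw [← (hF k).2 (u k), Matrix.sum_apply]
  ext x y
  simp only [Matrix.sum_apply, _root_.productStrategy, of_apply]
  rw [← Fintype.prod_sum fun k o => F k (u k) o (x k) (y k)]
  simp [hsum, one_apply, Finset.prod_ite_zero, funext_iff]

variable [∀ k, Fintype (I k)] {H : NonlocalGame I O} {b : ℝ}

theorem expectedScore_le_quantumValue (hscore : ∀ u t, H.score u t ≤ b) {d : Fin r → ℕ}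
    {F : ∀ k, I k → O k → Matrix (Fin (d k)) (Fin (d k)) ℂ}
    {φ : Matrix (∀ k, Fin (d k)) (∀ k, Fin (d k)) ℂ} (hF : ∀ k, IsMeasurementStrategy (F k))
    (hφ : IsState φ) : H.expectedScore (productStrategy F) φ ≤ quantumValue H := by
  refine le_csSup ⟨b, ?_⟩ ⟨d, F, φ, hF, hφ, rfl⟩
  rintro _ ⟨d, F, φ, hF, hφ, rfl⟩
  have hprod := IsMeasurementStrategy.productStrategy hF
  calc H.expectedScore (productStrategy F) φ
      ≤ H.expectation (productStrategy F) φ fun _ _ => b :=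
        Game.expectation_mono hprod.1 hφ.1 hscore
    _ = b := by rw [H.expectation_const, H.expectation_one hprod, hφ.2, Complex.one_re, mul_one]

theorem expectedScore_le_quantumValue_mul_trace (hscore : ∀ u t, H.score u t ≤ b)
    {d : Fin r → ℕ} {F : ∀ k, I k → O k → Matrix (Fin (d k)) (Fin (d k)) ℂ}
    {σ : Matrix (∀ k, Fin (d k)) (∀ k, Fin (d k)) ℂ} (hF : ∀ k, IsMeasurementStrategy (F k))
    (hσ : σ.PosSemidef) :
    H.expectedScore (productStrategy F) σ ≤ quantumValue H * σ.trace.re := by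
  have htrace : σ.trace = σ.trace.re := Complex.eq_re_of_ofReal_le hσ.trace_nonneg
  rcases (Complex.le_def.mp hσ.trace_nonneg).1.eq_or_lt with h0 | hpos
  · have hσ0 : σ = 0 := hσ.trace_eq_zero_iff.mp (by rw [htrace, ← h0, Complex.zero_re]; rfl)
    simp [hσ0, Game.expectedScore]
  rw [Complex.zero_re] at hpos
  have hstate : IsState (σ.trace.re⁻¹ • σ) := by
    refine ⟨hσ.smul (inv_nonneg.mpr hpos.le), ?_⟩
    rw [trace_smul, htrace, Complex.ofReal_re, Complex.real_smul, ← Complex.ofReal_mul,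
      inv_mul_cancel₀ hpos.ne', Complex.ofReal_one]
  have hle := expectedScore_le_quantumValue hscore hF hstate
  rw [show H.expectedScore _ _ = _ from H.expectation_smul_state _ _ _ _,
    inv_mul_le_iff₀ hpos, mul_comm] at hle
  exact hle

theorem IsPartite.expectedScore_le {Q : Type*} [Fintype Q]
    {E : (∀ k, I k) → (∀ k, O k) → Matrix Q Q ℂ} (hE : IsPartite E)
    (hscore : ∀ u t, H.score u t ≤ b) {φ : Matrix Q Q ℂ} (hφ : φ.PosSemidef) :
    H.expectedScore E φ ≤ quantumValue H * H.expectation E φ 1 := by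
  obtain ⟨d, F, V, hF, -, hV⟩ := hE
  obtain rfl : E = fun u t => V * productStrategy F u t * Vᴴ := funext₂ hV
  rw [show H.expectedScore _ φ = _ from H.expectation_conj _ V φ _, H.expectation_conj,
    H.expectation_one (.productStrategy hF)]
  exact expectedScore_le_quantumValue_mul_trace hscore hF (hφ.conjTranspose_mul_mul_same V)

end QuantumValue

section InvSqrt

variable {Q : Type*} [Fintype Q] [DecidableEq Q] {A B : Matrix Q Q ℂ}

theorem mul_sqrt_mul_invSqrt (hA : A.PosSemidef) : A * (cfc Real.sqrt A * invSqrt A) = A := by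
  have hcont : ∀ f : ℝ → ℝ, ContinuousOn f (spectrum ℝ A) := A.finite_real_spectrum.continuousOn
  have hself : IsSelfAdjoint A := hA.isHermitian
  have hid : Set.EqOn (fun x : ℝ => x * (√x * (√x)⁻¹)) id (spectrum ℝ A) := fun x hx => by
    rw [hA.isHermitian.spectrum_real_eq_range_eigenvalues] at hx
    obtain ⟨j, rfl⟩ := hx
    rcases (hA.eigenvalues_nonneg j).eq_or_lt with h0 | hpos
    · simp [← h0]
    · simp [(Real.sqrt_pos.mpr hpos).ne']
  calc A * (cfc Real.sqrt A * invSqrt A)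
      = cfc id A * (cfc Real.sqrt A * cfc (fun x : ℝ => (√x)⁻¹) A) := by rw [cfc_id ℝ A, invSqrt]
    _ = cfc (fun x : ℝ => x * (√x * (√x)⁻¹)) A := by
        rw [← cfc_mul _ _ A (hcont _) (hcont _), ← cfc_mul _ _ A (hcont _) (hcont _)]; rfl
    _ = A := by rw [cfc_congr hid, cfc_id ℝ A]

open scoped MatrixOrder in
theorem sqrt_mul_invSqrt_conj_mul_sqrt (hB : B.PosSemidef) (hBA : B ≤ A) :
    cfc Real.sqrt A * (invSqrt A * B * invSqrt A) * cfc Real.sqrt A = B := by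
  have hA : A.PosSemidef := (hB.nonneg.trans hBA).posSemidef
  have hcomm : cfc Real.sqrt A * invSqrt A = invSqrt A * cfc Real.sqrt A :=
    cfc_commute_cfc _ _ A
  have hright : B * (cfc Real.sqrt A * invSqrt A) = B := by
    have hzero : B * (cfc Real.sqrt A * invSqrt A - 1) = 0 :=
      mul_eq_zero_of_posSemidef_of_le hB hBA (by
        rw [Matrix.mul_sub, mul_sqrt_mul_invSqrt hA, Matrix.mul_one, sub_self])
    rwa [Matrix.mul_sub, Matrix.mul_one, sub_eq_zero] at hzero
  have hleft : cfc Real.sqrt A * invSqrt A * B = B := by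
    have hsqrt : star (cfc Real.sqrt A) = cfc Real.sqrt A :=
      (cfc_predicate Real.sqrt A : IsSelfAdjoint _)
    have hinvSqrt : star (invSqrt A) = invSqrt A :=
      (cfc_predicate (fun x : ℝ => (√x)⁻¹) A : IsSelfAdjoint _)
    have hstar := congrArg star hright
    rwa [star_mul, star_mul, hsqrt, hinvSqrt, hB.isHermitian.isSelfAdjoint.star_eq,
      ← hcomm] at hstar
  calc cfc Real.sqrt A * (invSqrt A * B * invSqrt A) * cfc Real.sqrt A
      = cfc Real.sqrt A * invSqrt A * B * (invSqrt A * cfc Real.sqrt A) := by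
        simp only [Matrix.mul_assoc]
    _ = B := by rw [hleft, ← hcomm, hright]

end InvSqrt

section Rounds

variable {N : ℕ} {U T Q : Type*} [Fintype T]

/-- The unnormalized conditional strategy for round `i` after the inputs `u j` and outputs `t j`
of the rounds `j < i`; `conditionalStrategy` is its compression by `invSqrt`. -/
noncomputable def roundStrategy (F : (Fin N → U) → (Fin N → T) → Matrix Q Q ℂ) (i : Fin N)
    (u : Fin N → U) (t : Fin N → T) (v : U) (s : T) : Matrix Q Q ℂ :=
  prefixOp F (i + 1) (Function.update u i v) (Function.update t i s)

/-- The unnormalized strategy for the last `N` of `N + 1` rounds when the input and output of the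
first round are `v` and `s`. -/
def afterFirstRound (F : (Fin (N + 1) → U) → (Fin (N + 1) → T) → Matrix Q Q ℂ) (v : U) (s : T)
    (u : Fin N → U) (t : Fin N → T) : Matrix Q Q ℂ :=
  F (Fin.cons v u) (Fin.cons s t)

theorem prefixOp_cons (F : (Fin (N + 1) → U) → (Fin (N + 1) → T) → Matrix Q Q ℂ) (i : ℕ) (v : U)
    (s : T) (u : Fin N → U) (t : Fin N → T) :
    prefixOp F (i + 1) (Fin.cons v u) (Fin.cons s t) = prefixOp (afterFirstRound F v s) i u t := by
  classical
  simp only [prefixOp, afterFirstRound, Finset.sum_filter]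
  rw [← (Fin.consEquiv fun _ => T).sum_comp, Fintype.sum_prod_type]
  simp [Fin.forall_fin_succ, ite_and, Fin.consEquiv]

theorem prefixOp_zero (F : (Fin N → U) → (Fin N → T) → Matrix Q Q ℂ) (u : Fin N → U)
    (t : Fin N → T) : prefixOp F 0 u t = ∑ s, F u s := by
  simp [prefixOp]

theorem roundStrategy_succ_cons (F : (Fin (N + 1) → U) → (Fin (N + 1) → T) → Matrix Q Q ℂ)
    (i : Fin N) (v : U) (s : T) (u : Fin N → U) (t : Fin N → T) :
    roundStrategy F i.succ (Fin.cons v u) (Fin.cons s t) =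
      roundStrategy (afterFirstRound F v s) i u t := by
  ext1 v'; ext1 s'
  simp only [roundStrategy, ← Fin.cons_update, Fin.val_succ, prefixOp_cons]

theorem roundStrategy_zero_cons (F : (Fin (N + 1) → U) → (Fin (N + 1) → T) → Matrix Q Q ℂ)
    (v : U) (s : T) (u : Fin N → U) (t : Fin N → T) :
    roundStrategy F 0 (Fin.cons v u) (Fin.cons s t) =
      fun v' s' => ∑ t', afterFirstRound F v' s' u t' := by
  ext1 v'; ext1 s'
  simp only [roundStrategy, Fin.update_cons_zero, Fin.val_zero, prefixOp_cons, prefixOp_zero]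

theorem posSemidef_prefixOp {F : (Fin N → U) → (Fin N → T) → Matrix Q Q ℂ}
    (hF : ∀ u t, (F u t).PosSemidef) (i : ℕ) (u : Fin N → U) (t : Fin N → T) :
    (prefixOp F i u t).PosSemidef :=
  posSemidef_sum _ fun s _ => hF u s

theorem sum_prefixOp_succ_update (F : (Fin N → U) → (Fin N → T) → Matrix Q Q ℂ) (i : Fin N)
    (u : Fin N → U) (t : Fin N → T) :
    ∑ s, prefixOp F (i + 1) u (Function.update t i s) = prefixOp F i u t := by
  classical
  have hagree : ∀ (w : Fin N → T) (s : T),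
      (∀ j : Fin N, (j : ℕ) < i + 1 → w j = Function.update t i s j) ↔
        w i = s ∧ ∀ j : Fin N, (j : ℕ) < i → w j = t j := fun w s => by
    simp only [Nat.lt_succ_iff_lt_or_eq, or_imp, forall_and, Fin.val_inj, forall_eq,
      Function.update_self, and_comm (a := w i = s)]
    refine and_congr_left' (forall₂_congr fun j hj => ?_)
    rw [Function.update_of_ne (Fin.ne_of_lt hj)]
  simp only [prefixOp, Finset.sum_filter, hagree, ite_and]
  rw [Finset.sum_comm]
  simp

theorem IsSequential.sum_roundStrategy {F : (Fin N → U) → (Fin N → T) → Matrix Q Q ℂ}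
    (hF : IsSequential F) (i : Fin N) (u : Fin N → U) (t : Fin N → T) (v : U) :
    ∑ s, roundStrategy F i u t v s = prefixOp F i u t := by
  simp only [roundStrategy, sum_prefixOp_succ_update]
  exact hF i i.2.le _ _ _ fun j hj => Function.update_of_ne (Fin.ne_of_lt hj) _ _

end Rounds

section Repeated

variable {N : ℕ} {U T Q : Type*} [Fintype U] [Fintype T] [Fintype Q]

namespace Game

/-- In every round, whatever happened before, the conditional expectation of the score of `H` is
at most `ω`; both sides are multiplied by the probability of the preceding rounds. -/
def RoundExpectationLE (H : Game U T) (F : (Fin N → U) → (Fin N → T) → Matrix Q Q ℂ)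
    (φ : Matrix Q Q ℂ) (ω : ℝ) : Prop :=
  ∀ i u t, H.expectedScore (roundStrategy F i u t) φ ≤
    ω * H.expectation (roundStrategy F i u t) φ 1

variable {H : Game U T} {φ : Matrix Q Q ℂ} {ω : ℝ}

theorem RoundExpectationLE.afterFirstRound
    {F : (Fin (N + 1) → U) → (Fin (N + 1) → T) → Matrix Q Q ℂ}
    (h : H.RoundExpectationLE F φ ω) (v : U) (s : T) :
    H.RoundExpectationLE (afterFirstRound F v s) φ ω := fun i u t => by
  simpa only [roundStrategy_succ_cons] using h i.succ (Fin.cons v u) (Fin.cons s t)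

theorem RoundExpectationLE.firstRound
    {F : (Fin (N + 1) → U) → (Fin (N + 1) → T) → Matrix Q Q ℂ}
    (h : H.RoundExpectationLE F φ ω) (u : Fin N → U) :
    H.expectation (fun v s => ∑ t, _root_.afterFirstRound F v s u t) φ H.score ≤
      ω * H.expectation (fun v s => ∑ t, _root_.afterFirstRound F v s u t) φ 1 := by
  rcases isEmpty_or_nonempty U with hU | ⟨⟨v⟩⟩
  · simp [expectation]
  rcases isEmpty_or_nonempty T with hT | ⟨⟨s⟩⟩
  · simp [expectation]
  simpa only [roundStrategy_zero_cons] using! h 0 (Fin.cons v u) (Fin.cons s fun _ => s)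

theorem expectation_repeated_succ (H : Game U T)
    (F : (Fin (N + 1) → U) → (Fin (N + 1) → T) → Matrix Q Q ℂ) (φ : Matrix Q Q ℂ)
    (X : (Fin (N + 1) → U) → (Fin (N + 1) → T) → ℝ) :
    (H.repeated (N + 1)).expectation F φ X =
      ∑ v, ∑ s, H.dist v * (H.repeated N).expectation (afterFirstRound F v s) φ
        fun u t => X (Fin.cons v u) (Fin.cons s t) := by
  simp only [expectation, repeated, afterFirstRound, Finset.mul_sum]
  rw [← (Fin.consEquiv fun _ => U).sum_comp, Fintype.sum_prod_type]
  refine Finset.sum_congr rfl fun v _ => ?_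
  rw [Finset.sum_comm (s := (Finset.univ : Finset T))]
  refine Finset.sum_congr rfl fun u _ => ?_
  rw [← (Fin.consEquiv fun _ => T).sum_comp, Fintype.sum_prod_type]
  simp [Fin.prod_univ_succ, Fin.consEquiv, mul_assoc]

theorem expectation_repeated_succ_firstRound (H : Game U T)
    (F : (Fin (N + 1) → U) → (Fin (N + 1) → T) → Matrix Q Q ℂ) (φ : Matrix Q Q ℂ)
    (X : U → T → ℝ) :
    (H.repeated (N + 1)).expectation F φ (fun u t => X (u 0) (t 0)) =
      ∑ u, (H.repeated N).dist u *
        H.expectation (fun v s => ∑ t, afterFirstRound F v s u t) φ X := by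
  rw [expectation_repeated_succ]
  simp only [expectation, Fin.cons_zero, Finset.sum_mul, trace_sum, Complex.re_sum,
    Finset.mul_sum]
  rw [Finset.sum_comm (s := (Finset.univ : Finset (Fin N → U)))]
  refine Finset.sum_congr rfl fun v _ => ?_
  rw [Finset.sum_comm (s := (Finset.univ : Finset (Fin N → U)))]
  simp only [mul_assoc, mul_left_comm]

theorem RoundExpectationLE.expectation_exp_firstRound_le
    {F : (Fin (N + 1) → U) → (Fin (N + 1) → T) → Matrix Q Q ℂ}
    (h : H.RoundExpectationLE F φ ω) (hF : ∀ u t, (F u t).PosSemidef) (hφ : φ.PosSemidef)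
    {a b : ℝ} (hscore : ∀ u t, H.score u t ∈ Set.Icc a b) {l : ℝ} (hl : 0 ≤ l) :
    (H.repeated (N + 1)).expectation F φ (fun u t => Real.exp (l * H.score (u 0) (t 0))) ≤
      Real.exp (l * ω + l ^ 2 * (b - a) ^ 2 / 8) * (H.repeated (N + 1)).expectation F φ 1 := by
  rw [H.expectation_repeated_succ_firstRound F φ fun v s => Real.exp (l * H.score v s),
    show (H.repeated (N + 1)).expectation F φ 1 = _ from
      H.expectation_repeated_succ_firstRound F φ 1, Finset.mul_sum]
  refine Finset.sum_le_sum fun u _ => ?_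
  rw [mul_left_comm]
  exact mul_le_mul_of_nonneg_left
    (expectation_exp_le (fun v s => posSemidef_sum _ fun t _ => hF _ _) hφ hscore
      (h.firstRound u) hl) ((H.repeated N).dist_nonneg u)

theorem RoundExpectationLE.expectation_exp_repeated_le
    {F : (Fin N → U) → (Fin N → T) → Matrix Q Q ℂ}
    (h : H.RoundExpectationLE F φ ω) (hF : ∀ u t, (F u t).PosSemidef) (hφ : φ.PosSemidef)
    {a b : ℝ} (hscore : ∀ u t, H.score u t ∈ Set.Icc a b) {l : ℝ} (hl : 0 ≤ l) :
    (H.repeated N).expectation F φ (fun u t => Real.exp (l * (H.repeated N).score u t)) ≤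
      Real.exp (l * ω + l ^ 2 * (b - a) ^ 2 / 8) ^ N * (H.repeated N).expectation F φ 1 := by
  induction N with
  | zero => simp [expectation, repeated]
  | succ N ih =>
    set C := Real.exp (l * ω + l ^ 2 * (b - a) ^ 2 / 8)
    have hsplit : ∀ v s (u : Fin N → U) (t : Fin N → T),
        Real.exp (l * (H.repeated (N + 1)).score (Fin.cons v u) (Fin.cons s t)) =
          Real.exp (l * H.score v s) * Real.exp (l * (H.repeated N).score u t) := by
      intro v s u t
      simp only [repeated, Fin.sum_univ_succ, Fin.cons_zero, Fin.cons_succ, mul_add, Real.exp_add]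
    calc (H.repeated (N + 1)).expectation F φ
          (fun u t => Real.exp (l * (H.repeated (N + 1)).score u t))
        = ∑ v, ∑ s, H.dist v * (Real.exp (l * H.score v s) *
            (H.repeated N).expectation (_root_.afterFirstRound F v s) φ
              fun u t => Real.exp (l * (H.repeated N).score u t)) := by
          simp only [expectation_repeated_succ, hsplit, expectation_const_mul]
      _ ≤ ∑ v, ∑ s, H.dist v * (Real.exp (l * H.score v s) *
            (C ^ N * (H.repeated N).expectation (_root_.afterFirstRound F v s) φ 1)) := by
          gcongr with v _ s _
          · exact H.dist_nonneg v
          · exact ih (h.afterFirstRound v s) fun u t => hF _ _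
      _ = C ^ N * (H.repeated (N + 1)).expectation F φ
            (fun u t => Real.exp (l * H.score (u 0) (t 0))) := by
          simp only [expectation_repeated_succ, Fin.cons_zero,
            expectation_const _ _ _ (Real.exp _), Finset.mul_sum, mul_left_comm]
      _ ≤ C ^ N * (C * (H.repeated (N + 1)).expectation F φ 1) := by
          gcongr
          exact h.expectation_exp_firstRound_le hF hφ hscore hl
      _ = C ^ (N + 1) * (H.repeated (N + 1)).expectation F φ 1 := by rw [pow_succ, mul_assoc]

theorem RoundExpectationLE.probScoreExceeds_repeated_le [DecidableEq Q]
    {F : (Fin N → U) → (Fin N → T) → Matrix Q Q ℂ} (h : H.RoundExpectationLE F φ ω)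
    (hF : IsMeasurementStrategy F) (hφ : IsState φ) {a b : ℝ} (hab : a < b)
    (hscore : ∀ u t, H.score u t ∈ Set.Icc a b) {δ : ℝ} (hδ : 0 ≤ δ) :
    (H.repeated N).probScoreExceeds F φ ((ω + δ) * N) ≤
      Real.exp (-(2 * N * δ ^ 2) / (b - a) ^ 2) := by
  have hba : 0 < b - a := sub_pos.mpr hab
  -- minimizes the exponent `N * (l ^ 2 * (b - a) ^ 2 / 8 - l * δ)`
  let l := 4 * δ / (b - a) ^ 2
  have hl : 0 ≤ l := by positivity
  calc (H.repeated N).probScoreExceeds F φ ((ω + δ) * N)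
      ≤ Real.exp (-(l * ((ω + δ) * N))) * (H.repeated N).expectation F φ
          fun u t => Real.exp (l * (H.repeated N).score u t) :=
        probScoreExceeds_le_exp_mul_expectation hF.1 hφ.1 _ hl
    _ ≤ Real.exp (-(l * ((ω + δ) * N))) *
          (Real.exp (l * ω + l ^ 2 * (b - a) ^ 2 / 8) ^ N *
            (H.repeated N).expectation F φ 1) := by
        gcongr
        exact h.expectation_exp_repeated_le hF.1 hφ.1 hscore hl
    _ = Real.exp (-(2 * N * δ ^ 2) / (b - a) ^ 2) := by
        rw [expectation_one _ hF, hφ.2, Complex.one_re, mul_one, ← Real.exp_nat_mul,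
          ← Real.exp_add]
        congr 1
        simp only [l]
        field_simp
        ring

end Game

end Repeated

section Partite

variable {r N : ℕ} {I O : Fin r → Type*} [∀ k, Fintype (I k)] [∀ k, Fintype (O k)]
  {H : NonlocalGame I O} {Q : Type*} [Fintype Q] [DecidableEq Q]
  {F : (Fin N → ∀ k, I k) → (Fin N → ∀ k, O k) → Matrix Q Q ℂ} {φ : Matrix Q Q ℂ}

open scoped MatrixOrder in
theorem IsPartiteSequentialStrategy.roundExpectationLE_quantumValue
    (hF : IsPartiteSequentialStrategy F) {b : ℝ} (hscore : ∀ u t, H.score u t ≤ b)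
    (hφ : φ.PosSemidef) : H.RoundExpectationLE F φ (quantumValue H) := fun i u t => by
  have hpos : ∀ v s, (roundStrategy F i u t v s).PosSemidef := fun v s =>
    posSemidef_prefixOp hF.measurement.1 _ _ _
  have hle : ∀ v s, roundStrategy F i u t v s ≤ prefixOp F i u t := fun v s => by
    rw [← hF.sequential.sum_roundStrategy i u t v]
    exact Finset.single_le_sum (f := roundStrategy F i u t v) (fun s _ => (hpos v s).nonneg)
      (Finset.mem_univ s)
  by_cases hA : prefixOp F i u t = 0
  · have hzero : ∀ v s, roundStrategy F i u t v s = 0 := fun v s =>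
      ((hle v s).trans_eq hA).antisymm (hpos v s).nonneg
    simp [Game.expectedScore, Game.expectation, hzero]
  set S : Matrix Q Q ℂ := cfc Real.sqrt (prefixOp F i u t)
  have hS : Sᴴ = S := (cfc_predicate Real.sqrt (prefixOp F i u t) : IsSelfAdjoint _)
  have hconj : roundStrategy F i u t = fun v s => S * conditionalStrategy F i u t v s * Sᴴ :=
    funext₂ fun v s => by
      rw [hS]
      exact (sqrt_mul_invSqrt_conj_mul_sqrt (hpos v s) (hle v s)).symm
  rw [hconj, show H.expectedScore _ φ = _ from H.expectation_conj _ S φ _, H.expectation_conj]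
  exact (hF.partite i u t hA).expectedScore_le hscore (hφ.conjTranspose_mul_mul_same S)

theorem mainTheorem5_general (hF : IsPartiteSequentialStrategy F) (hφ : IsState φ) {a b : ℝ}
    (hab : a < b) (hscore : ∀ u t, H.score u t ∈ Set.Icc a b) {δ : ℝ} (hδ : 0 ≤ δ) :
    (H.repeated N).probScoreExceeds F φ ((quantumValue H + δ) * N) ≤
      Real.exp (-(2 * N * δ ^ 2) / (b - a) ^ 2) :=
  (hF.roundExpectationLE_quantumValue (fun u t => (hscore u t).2) hφ.1).probScoreExceeds_repeated_le
    hF.measurement hφ hab hscore hδ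

end Partite

theorem mainTheorem5 {r : ℕ} {I O : Fin r → Type*} [∀ k, Fintype (I k)] [∀ k, Fintype (O k)]
    (H : NonlocalGame I O) (K : ℝ) (hK : 0 < K) (hscore : ∀ u t, H.score u t ∈ Set.Icc (-K) K)
    (N : ℕ) {Q : Type*} [Fintype Q] [DecidableEq Q]
    (F : (Fin N → ∀ k, I k) → (Fin N → ∀ k, O k) → Matrix Q Q ℂ) (φ : Matrix Q Q ℂ)
    (hF : IsPartiteSequentialStrategy F) (hφ : IsState φ) (δ : ℝ) (hδ : 0 ≤ δ) :
    (H.repeated N).probScoreExceeds F φ ((quantumValue H + δ) * N) ≤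
      Real.exp (-(N * δ ^ 2) / (8 * K ^ 2)) := by
  refine (mainTheorem5_general hF hφ (neg_lt_self hK) hscore hδ).trans (Real.exp_le_exp.mpr ?_)
  rw [sub_neg_eq_add, ← two_mul, div_le_div_iff₀ (by positivity) (by positivity)]
  nlinarith [show 0 ≤ N * δ ^ 2 * K ^ 2 by positivity]
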